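/- For real $x$ let $\|x\|=\min_{a\in\mathbb Z}|x-a|$, and for real $\alpha$ and real $t\ge 1$ let $$\psi_\alpha(t)=\min_{q\in\mathbb Z_+,\ q\le t}\|q\alpha\| .$$ Two real numbers $\alpha,\beta$ are called incommensurable if $\psi_\alpha(t)\neq\psi_\beta(t)$ for all sufficiently large $t$. For an $n$-tuple $\boldsymbol\alpha=(\alpha_1,\dots,\alpha_n)$ of pairwise incommensurable real numbers and all sufficiently large $t$, let $\boldsymbol\sigma(t)=(\sigma_1,\dots,\sigma_n)$ be the permutation of $\{1,\dots,n\}$ with $$\psi_{\alpha_{\sigma_1}}(t)>\psi_{\alpha_{\sigma_2}}(t)>\dots>\psi_{\alpha_{\sigma_n}}(t).$$ The $\mathfrak k$-index $\mathfrak k(\boldsymbol\alpha)$ is the largest $m$ for which there exist $m$ distinct permutations $\boldsymbol\sigma_1,\dots,\boldsymbol\sigma_m$ such that for every $j$ and every $t_0>0$ there is a $t>t_0$ with $\boldsymbol\sigma(t)=\boldsymbol\sigma_j$. **Theorem.** Let $k\ge 3$ be an integer and $n=\frac{k(k+1)}{2}$. Then there is an $n$-tuple $\boldsymbol\alpha$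 of pairwise incommensurable real numbers with $\mathfrak k(\boldsymbol\alpha)=k$. -/

import Mathlib

/-- The distance `‖x‖ = min_{a ∈ ℤ} |x - a|` from a real number to the nearest integer. -/
noncomputable def distInt (x : ℝ) : ℝ := |x - round x|

theorem isLeast_distInt (x : ℝ) :
    IsLeast (Set.range fun a : ℤ => |x - (a : ℝ)|) (distInt x) :=
  ⟨⟨round x, rfl⟩, by rintro _ ⟨a, rfl⟩; exact round_le x a⟩

/-- The irrationality measure function `ψ_α(t) = min_{q ∈ ℤ₊, q ≤ t} ‖q α‖`
(the minimum is over a non-empty finite set as soon as `1 ≤ t`). -/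
noncomputable def psi (α t : ℝ) : ℝ :=
  sInf ((fun q : ℕ => distInt (q * α)) '' {q : ℕ | 0 < q ∧ (q : ℝ) ≤ t})

theorem isLeast_psi (α : ℝ) {t : ℝ} (ht : 1 ≤ t) :
    IsLeast ((fun q : ℕ => distInt (q * α)) '' {q : ℕ | 0 < q ∧ (q : ℝ) ≤ t}) (psi α t) := by
  have hfin : {q : ℕ | 0 < q ∧ (q : ℝ) ≤ t}.Finite :=
    (Set.finite_Iic ⌊t⌋₊).subset fun q hq => Nat.le_floor hq.2
  have hne : {q : ℕ | 0 < q ∧ (q : ℝ) ≤ t}.Nonempty := ⟨1, one_pos, by simpa using ht⟩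
  exact ⟨(hne.image _).csInf_mem (hfin.image _),
    fun y hy => csInf_le (hfin.image _).bddBelow hy⟩

/-- `α` and `β` are incommensurable: `ψ_α(t) ≠ ψ_β(t)` for all sufficiently large real `t`. -/
def Incommensurable (α β : ℝ) : Prop :=
  ∀ᶠ t : ℝ in Filter.atTop, psi α t ≠ psi β t

/-- The permutation `σ` is the ordering `σ(t)` of the tuple `α` at `t`:
`ψ_{α_{σ_1}}(t) > ψ_{α_{σ_2}}(t) > ... > ψ_{α_{σ_n}}(t)`. -/
def IsOrderingAt {n : ℕ} (α : Fin n → ℝ) (t : ℝ) (σ : Equiv.Perm (Fin n)) : Prop :=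
  StrictAnti fun j : Fin n => psi (α (σ j)) t

/-- The set of those `m` for which there are `m` distinct permutations
each of which is the ordering of `α` at arbitrarily large `t`. -/
def recurrenceCounts {n : ℕ} (α : Fin n → ℝ) : Set ℕ :=
  {m | ∃ σ : Fin m → Equiv.Perm (Fin n), Function.Injective σ ∧
    ∀ j : Fin m, ∀ t₀ : ℝ, 0 < t₀ → ∃ t : ℝ, t₀ < t ∧ IsOrderingAt α t (σ j)}

/-- The `𝔨`-index of a tuple: the largest number of distinct recurring orderings. -/
noncomputable def kIndex {n : ℕ} (α : Fin n → ℝ) : ℕ := sSup (recurrenceCounts α)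

theorem isGreatest_kIndex {n : ℕ} (α : Fin n → ℝ) :
    IsGreatest (recurrenceCounts α) (kIndex α) := by
  have hb : BddAbove (recurrenceCounts α) := by
    refine ⟨Fintype.card (Equiv.Perm (Fin n)), ?_⟩
    rintro m ⟨σ, hσ, -⟩
    simpa using Fintype.card_le_of_injective σ hσ
  have hne : (recurrenceCounts α).Nonempty :=
    ⟨0, fun j => j.elim0, fun j => j.elim0, fun j => j.elim0⟩
  exact ⟨Nat.sSup_mem hne hb, fun m hm => le_csSup hb hm⟩

/-!
The `n = k (k + 1) / 2` numbers are indexed by the unordered pairs `{a, b}` of residues modulo `k`,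
where `a = b` is allowed. All of them take the denominators of their convergents from one common,
fast growing sequence `T 0 < T 1 < T 2 < ⋯`: the number `α_s` with `s = {a, b}` has the convergent
denominators `T m` with `m` congruent to `a` or `b` modulo `k`, so `T m` are the times at which
`ψ_{α_s}` drops. Such numbers exist as soon as any three consecutive denominators `q, q', q''` of
`α_s` satisfy `q'' ≡ q` modulo `q'` and the first two are coprime
(`exists_real_with_denominators`). For a given `m` the middle terms `q'` that occur with
`q'' = T m` are `T (m - 1), …, T (m - k)`. These can be kept pairwise coprime, so that the
Chinese remainder theorem provides `T m` (`exists_isDenominatorSeq`).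

On a stretch `[T (m - 1), T m)` let `q` be the current denominator of `α_s`, and `q'`, `q''` its next
two denominators. Then `ψ_{α_s} = δ` and `q' δ + q δ' = 1`, where `δ'` is the value after the next
drop, with `1 / 2 < q' δ < 1` and `1 / 2 < q'' δ' < 1`. So a smaller `q'` gives the larger value of
`ψ`. If two numbers share `q'`, then the one with the larger `q''` has the smaller `q δ'`, hence the
larger `δ` (`IsDenominatorSeq.psi_lt_psi`). Two numbers cannot share both `q'` and `q''`: the
residues of the indices of `q'` and `q''` in the sequence `T` determine the pair `{a, b}`, a
difference of `k` between these indices meaning `a = b` (`orderKey_injective`).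

Thus the numbers are pairwise incommensurable and their ordering on `[T (m - 1), T m)` depends only
on the residue of `m` modulo `k`. The `k` orderings obtained are distinct, since the largest value
belongs to the pair `{m, m}` (`orderKey_diag_lt` compares these pairs). Hence the index is `k`.
-/

/-! ### Real numbers with prescribed denominators of best approximations -/

/-- If `p ν / q ν` obeys the continued-fraction recursion, there is a real number strictly above
all convergents of even index and strictly below all convergents of odd index. -/
theorem exists_real_between_convergents (p : ℕ → ℤ) (q a : ℕ → ℕ) (hq : ∀ ν, 0 < q ν)
    (ha : ∀ ν, 0 < a ν) (hqr : ∀ ν, q (ν + 2) = a ν * q (ν + 1) + q ν)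
    (hdet : ∀ ν, p (ν + 1) * q ν - p ν * q (ν + 1) = (-1) ^ ν)
    (hpr : ∀ ν, p (ν + 2) = a ν * p (ν + 1) + p ν) :
    ∃ α : ℝ, ∀ ν, 0 < (-1) ^ ν * (q ν * α - p ν) := by
  have hq' : ∀ ν, (0 : ℝ) < q ν := fun ν => by exact_mod_cast hq ν
  have hdet' : ∀ ν, (p (ν + 1) : ℝ) * q ν - p ν * q (ν + 1) = (-1) ^ ν := fun ν => by
    exact_mod_cast hdet ν
  -- Convergents two steps apart: the determinant is the previous one times the partial quotient.
  have hdet2 : ∀ ν, (p (ν + 2) : ℝ) * q ν - p ν * q (ν + 2) = a ν * (-1) ^ ν := fun ν => by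
    rw [← hdet' ν, hpr, hqr]; push_cast; ring
  have ha' : ∀ ν, (0 : ℝ) < a ν := fun ν => by exact_mod_cast ha ν
  set x : ℕ → ℝ := fun i => p (2 * i) / q (2 * i) with hx
  set y : ℕ → ℝ := fun i => p (2 * i + 1) / q (2 * i + 1) with hy
  have hxm : StrictMono x := strictMono_nat_of_lt_succ fun i => by
    have h := hdet2 (2 * i)
    rw [pow_mul] at h
    norm_num at h
    simp only [hx, mul_add, mul_one]
    rw [div_lt_div_iff₀ (hq' _) (hq' _)]
    linarith [ha' (2 * i)]
  have hym : StrictAnti y := strictAnti_nat_of_succ_lt fun i => by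
    have h := hdet2 (2 * i + 1)
    rw [pow_succ, pow_mul] at h
    norm_num at h
    have e : 2 * (i + 1) + 1 = 2 * i + 1 + 2 := by ring
    simp only [hy]
    rw [e, div_lt_div_iff₀ (hq' _) (hq' _)]
    linarith [ha' (2 * i + 1)]
  have hxy : x ≤ y := fun i => by
    have h := hdet' (2 * i)
    rw [pow_mul] at h
    norm_num at h
    simp only [hx, hy]
    rw [div_le_div_iff₀ (hq' _) (hq' _)]
    linarith
  have hmem := hxm.monotone.ciSup_mem_iInter_Icc_of_antitone hym.antitone hxy
  refine ⟨⨆ n, x n, fun ν => ?_⟩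
  set α := ⨆ n, x n
  rw [Set.mem_iInter] at hmem
  obtain ⟨i, rfl | rfl⟩ := ν.even_or_odd'
  · have h := (hxm (Nat.lt_succ_self i)).trans_le (hmem (i + 1)).1
    rw [pow_mul]
    simp only [hx] at h
    rw [div_lt_iff₀ (hq' _)] at h
    norm_num
    linarith
  · have h := (hmem (i + 1)).2.trans_lt (hym (Nat.lt_succ_self i))
    rw [pow_succ, pow_mul]
    simp only [hy] at h
    rw [lt_div_iff₀ (hq' _)] at h
    norm_num
    linarith

/-- Best approximation: consecutive convergents form a basis of the lattice of pairs `(Q, P)`,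
and below the next denominator the two terms of `Q * α - P` in this basis have the same sign. -/
theorem abs_mul_sub_ge_of_lt {p : ℕ → ℤ} {q : ℕ → ℕ} {α : ℝ}
    (hdet : ∀ ν, p (ν + 1) * q ν - p ν * q (ν + 1) = (-1) ^ ν)
    (hpos : ∀ ν, 0 < (-1) ^ ν * (q ν * α - p ν)) (ν : ℕ) {Q : ℕ} (hQ : 0 < Q)
    (hQν : Q < q (ν + 1)) (P : ℤ) :
    (-1) ^ ν * (q ν * α - p ν) ≤ |Q * α - P| := by
  set δ := (-1) ^ ν * (q ν * α - p ν) with hδ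
  set δ' := (-1) ^ (ν + 1) * (q (ν + 1) * α - p (ν + 1)) with hδ'
  have h0 : 0 < δ := hpos ν
  have h1 : 0 < δ' := hpos (ν + 1)
  have hs : ((-1 : ℤ) ^ ν) * (-1) ^ ν = 1 := by rw [← mul_pow]; simp
  -- Coordinates of `(Q, P)` in the unimodular basis of two consecutive convergents.
  obtain ⟨x, y, hx, hy⟩ : ∃ x y : ℤ, (Q : ℤ) = x * q ν + y * q (ν + 1) ∧
      P = x * p ν + y * p (ν + 1) := by
    refine ⟨(-1) ^ ν * (p (ν + 1) * Q - q (ν + 1) * P), (-1) ^ ν * (q ν * P - p ν * Q), ?_, ?_⟩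
    · linear_combination (-(Q : ℤ)) * hs - (Q : ℤ) * (-1) ^ ν * hdet ν
    · linear_combination (-P) * hs - P * (-1) ^ ν * hdet ν
  have hcomb : |(Q : ℝ) * α - P| = |x * δ - y * δ'| := by
    have hxr : (Q : ℝ) = x * q ν + y * q (ν + 1) := by exact_mod_cast hx
    have : x * δ - y * δ' = (-1) ^ ν * (Q * α - P) := by
      rw [hxr, hy, hδ, hδ', pow_succ]; push_cast; ring
    rw [this, abs_mul]; simp
  rw [hcomb]
  have hQ' : (0 : ℤ) < x * q ν + y * q (ν + 1) := by rw [← hx]; exact_mod_cast hQ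
  have hQν' : x * q ν + y * q (ν + 1) < (q (ν + 1) : ℤ) := by rw [← hx]; exact_mod_cast hQν
  have hqn : (0 : ℤ) ≤ q ν := Int.natCast_nonneg _
  have hqn1 : (0 : ℤ) ≤ q (ν + 1) := Int.natCast_nonneg _
  rcases lt_trichotomy y 0 with hy0 | hy0 | hy0
  · have hx1 : 1 ≤ x := by
      by_contra! h
      nlinarith
    have hx1' : (1 : ℝ) ≤ x := by exact_mod_cast hx1
    have hy0' : (y : ℝ) < 0 := by exact_mod_cast hy0
    refine le_trans ?_ (le_abs_self _)
    nlinarith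
  · subst hy0
    have hx1 : 1 ≤ x := by
      by_contra! h
      nlinarith
    have hx1' : (1 : ℝ) ≤ x := by exact_mod_cast hx1
    refine le_trans ?_ (le_abs_self _)
    push_cast
    nlinarith
  · have hx1 : x ≤ -1 := by
      by_contra! h
      nlinarith
    have hx1' : (x : ℝ) ≤ -1 := by exact_mod_cast hx1
    have hy0' : (0 : ℝ) < y := by exact_mod_cast hy0
    refine le_trans ?_ (neg_le_abs _)
    nlinarith

theorem psi_eq_of_forall_le {α t δ : ℝ} {q : ℕ} {p : ℤ} (hq : 0 < q) (hqt : q ≤ t)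
    (hle : ∀ Q : ℕ, 0 < Q → (Q : ℝ) ≤ t → ∀ P : ℤ, δ ≤ |Q * α - P|) (hδ : |q * α - p| = δ) :
    psi α t = δ := by
  have ht : (1 : ℝ) ≤ t := le_trans (by exact_mod_cast hq) hqt
  refine (isLeast_psi α ht).unique ⟨⟨q, ⟨hq, hqt⟩, ?_⟩, ?_⟩
  · exact le_antisymm ((round_le _ p).trans hδ.le) (hle q hq hqt _)
  · rintro _ ⟨Q, ⟨hQ, hQt⟩, rfl⟩
    exact hle Q hQ hQt _

/-- A recursion of continued-fraction type with coprime start is realised by a real number: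
`δ ν` is the distance from `q ν * α` to the nearest integer, the minimum of `‖q α‖` over
all `q < q (ν + 1)`. -/
theorem exists_real_with_denominators (q : ℕ → ℕ) (hq0 : 0 < q 0) (hq : StrictMono q)
    (hcop : (q 0).Coprime (q 1)) (hmod : ∀ ν, q (ν + 2) ≡ q ν [MOD q (ν + 1)]) :
    ∃ (α : ℝ) (δ : ℕ → ℝ), (∀ ν t, (q ν : ℝ) ≤ t → t < q (ν + 1) → psi α t = δ ν) ∧
      (∀ ν, q (ν + 1) * δ ν + q ν * δ (ν + 1) = 1) ∧ (∀ ν, 0 < δ ν) ∧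
      ∀ ν, δ (ν + 1) < δ ν := by
  have hqpos : ∀ ν, 0 < q ν := fun ν => hq0.trans_le (hq.monotone (Nat.zero_le ν))
  have hex : ∀ ν, ∃ a, 0 < a ∧ q (ν + 2) = a * q (ν + 1) + q ν := fun ν => by
    have hlt : q ν < q (ν + 2) := hq (by omega)
    obtain ⟨a, ha⟩ := (Nat.modEq_iff_dvd' hlt.le).1 (hmod ν).symm
    refine ⟨a, Nat.pos_of_ne_zero ?_, ?_⟩
    · rintro rfl
      rw [mul_zero] at ha
      omega
    · rw [mul_comm, ← ha]; omega
  choose a ha hqr using hex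
  -- Numerators: a Bézout solution for the first pair, continued by the same recursion.
  obtain ⟨p₀, p₁, h01⟩ : ∃ p₀ p₁ : ℤ, p₁ * q 0 - p₀ * q 1 = 1 := by
    obtain ⟨u, v, huv⟩ := Nat.isCoprime_iff_coprime.2 hcop
    exact ⟨-v, u, by linarith⟩
  let pp : ℕ → ℤ × ℤ := fun ν => Nat.rec (p₀, p₁) (fun ν z => (z.2, a ν * z.2 + z.1)) ν
  let p : ℕ → ℤ := fun ν => (pp ν).1
  have hpr : ∀ ν, p (ν + 2) = a ν * p (ν + 1) + p ν := fun ν => rfl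
  have hdet : ∀ ν, p (ν + 1) * q ν - p ν * q (ν + 1) = (-1) ^ ν := by
    intro ν
    induction ν with
    | zero => exact h01
    | succ ν ih =>
      rw [pow_succ, ← ih, hpr, hqr]; push_cast; ring
  obtain ⟨α, hα⟩ := exists_real_between_convergents p q a hqpos ha hqr hdet hpr
  refine ⟨α, fun ν => (-1) ^ ν * (q ν * α - p ν), ?_, ?_, hα, ?_⟩
  · intro ν t h1 h2
    refine psi_eq_of_forall_le (p := p ν) (hqpos ν) h1 (fun Q hQ hQt P => ?_) ?_
    · exact abs_mul_sub_ge_of_lt hdet hα ν hQ (by exact_mod_cast hQt.trans_lt h2) P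
    · change _ = (-1) ^ ν * (q ν * α - p ν)
      rw [← abs_of_pos (hα ν), abs_mul]; simp
  · intro ν
    have hs : ((-1 : ℝ) ^ ν) * (-1) ^ ν = 1 := by rw [← mul_pow]; simp
    have h : (p (ν + 1) : ℝ) * q ν - p ν * q (ν + 1) = (-1) ^ ν := by exact_mod_cast hdet ν
    simp only [pow_succ]
    linear_combination (-1 : ℝ) ^ ν * h + hs
  · intro ν
    have h1 : (1 : ℝ) ≤ a ν := by exact_mod_cast ha ν
    have h3 : (-1 : ℝ) ^ (ν + 2) * (q (ν + 2) * α - p (ν + 2)) =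
        (-1) ^ ν * (q ν * α - p ν) - a ν * ((-1) ^ (ν + 1) * (q (ν + 1) * α - p (ν + 1))) := by
      rw [hqr, hpr]; push_cast; ring
    have h4 := hα (ν + 2)
    have h5 := hα (ν + 1)
    rw [h3] at h4
    nlinarith

/-! ### The common sequence of denominators -/

/-- The arithmetic of the common denominators: `T` grows fast, any two terms at distance at
most `k` are coprime, and every selection of terms that is periodic with one or two terms per
period `k` satisfies the congruences of a sequence of convergent denominators. -/
structure IsDenominatorSeq (k : ℕ) (T : ℕ → ℕ) : Prop where
  pos : ∀ m, 0 < T m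
  growth : ∀ m, 2 * T m ^ 2 ≤ T (m + 1)
  coprime : ∀ m j, 0 < j → j ≤ k → (T m).Coprime (T (m + j))
  modEq : ∀ m j, 0 < j → j < k → T (m + k) ≡ T m [MOD T (m + j)]
  modEq_two_mul : ∀ m, T (m + 2 * k) ≡ T m [MOD T (m + k)]

/-- The induction step for the denominator sequence. The history is listed backwards:
`h j` is the term `j + 1` places before the new term `x`. -/
theorem exists_next_denominator {k : ℕ} (hk : 0 < k) (h : ℕ → ℕ) (hpos : ∀ j, 0 < h j)
    (hcop : ∀ i j, 0 < j → j ≤ k → (h i).Coprime (h (i + j))) :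
    ∃ x, 0 < x ∧ 2 * h 0 ^ 2 ≤ x ∧ (∀ j, j < k → x.Coprime (h j)) ∧
      (∀ j, j + 1 < k → x ≡ h (k - 1) [MOD h j]) ∧ x ≡ h (2 * k - 1) [MOD h (k - 1)] := by
  classical
  have hpair : Set.Pairwise (↑(Finset.range k)) (Function.onFun Nat.Coprime h) := by
    intro i hi j hj hij
    simp only [Finset.coe_range, Set.mem_Iio] at hi hj
    rcases lt_or_gt_of_ne hij with hlt | hlt
    · have := hcop i (j - i) (by omega) (by omega)
      rwa [Nat.add_sub_of_le hlt.le] at this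
    · have := (hcop j (i - j) (by omega) (by omega)).symm
      rwa [Nat.add_sub_of_le hlt.le] at this
  let res : ℕ → ℕ := fun j => if j + 1 < k then h (k - 1) else h (2 * k - 1)
  obtain ⟨y, hy⟩ := Nat.chineseRemainderOfFinset res h (Finset.range k)
    (fun i _ => (hpos i).ne') hpair
  set N := ∏ j ∈ Finset.range k, h j with hN
  have hNpos : 0 < N := Finset.prod_pos fun j _ => hpos j
  set x := y + N * (2 * h 0 ^ 2 + 1) with hx
  have hxle : 2 * h 0 ^ 2 + 1 ≤ x := by
    have := Nat.le_mul_of_pos_left (2 * h 0 ^ 2 + 1) hNpos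
    omega
  have hxmod : ∀ j, j < k → x ≡ res j [MOD h j] := fun j hj => by
    have hd : h j ∣ N := Finset.dvd_prod_of_mem h (Finset.mem_range.2 hj)
    have h0 : N * (2 * h 0 ^ 2 + 1) ≡ 0 [MOD h j] :=
      (Nat.modEq_zero_iff_dvd).2 (hd.mul_right _)
    simpa [hx] using (hy j (Finset.mem_range.2 hj)).add h0
  have hmod1 : ∀ j, j + 1 < k → x ≡ h (k - 1) [MOD h j] := fun j hj => by
    have := hxmod j (by omega)
    simpa only [res, if_pos hj] using this
  have hmod2 : x ≡ h (2 * k - 1) [MOD h (k - 1)] := by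
    have := hxmod (k - 1) (by omega)
    simpa only [res, if_neg (show ¬ (k - 1 + 1 < k) by omega)] using this
  refine ⟨x, by omega, by omega, fun j hj => ?_, hmod1, hmod2⟩
  by_cases hj' : j + 1 < k
  · have hc := hcop j (k - 1 - j) (by omega) (by omega)
    rw [show j + (k - 1 - j) = k - 1 by omega] at hc
    rw [Nat.Coprime, (hmod1 j hj').gcd_eq]
    exact hc.symm
  · obtain rfl : j = k - 1 := by omega
    have hc := hcop (k - 1) k hk le_rfl
    rw [show k - 1 + k = 2 * k - 1 by omega] at hc
    rw [Nat.Coprime, hmod2.gcd_eq]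
    exact hc.symm

theorem exists_isDenominatorSeq {k : ℕ} (hk : 0 < k) : ∃ T, IsDenominatorSeq k T := by
  -- A state is a history with its invariants; the initial history is constantly `1`.
  let S := {h : ℕ → ℕ // (∀ j, 0 < h j) ∧ ∀ i j, 0 < j → j ≤ k → (h i).Coprime (h (i + j))}
  have hstep : ∀ s : S, ∃ s' : S, (∀ j, s'.1 (j + 1) = s.1 j) ∧ 2 * s.1 0 ^ 2 ≤ s'.1 0 ∧
      (∀ j, j + 1 < k → s'.1 0 ≡ s.1 (k - 1) [MOD s.1 j]) ∧
      s'.1 0 ≡ s.1 (2 * k - 1) [MOD s.1 (k - 1)] := by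
    rintro ⟨h, hpos, hcop⟩
    obtain ⟨x, hx0, hxg, hxc, hx1, hx2⟩ := exists_next_denominator hk h hpos hcop
    refine ⟨⟨fun j => Nat.casesOn j x h, fun j => ?_, fun i j hj hjk => ?_⟩,
      fun _ => rfl, hxg, hx1, hx2⟩
    · cases j with
      | zero => exact hx0
      | succ j => exact hpos j
    · cases i with
      | zero =>
        obtain ⟨j, rfl⟩ := Nat.exists_eq_add_of_lt hj
        simpa [Nat.add_comm] using hxc j (by omega)
      | succ i =>
        rw [show i + 1 + j = (i + j) + 1 by omega]
        exact hcop i j hj hjk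
  choose nxt hshift hgrow hmod1 hmod2 using hstep
  let s : ℕ → S := fun M => Nat.rec ⟨fun _ => 1, by simp, by simp⟩ (fun _ z => nxt z) M
  have hs : ∀ M, s (M + 1) = nxt (s M) := fun M => rfl
  have hsT : ∀ j M, (s (M + j + 1)).1 j = (s (M + 1)).1 0 := by
    intro j
    induction j with
    | zero => intro M; rfl
    | succ j ih =>
      intro M
      rw [hs (M + (j + 1)), hshift]
      exact ih M
  have hcop : ∀ m j, 0 < j → j ≤ k → ((s (m + 1)).1 0).Coprime ((s (m + j + 1)).1 0) := by
    intro m j hj hjk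
    have h := (s (m + j + 1)).2.2 0 j hj hjk
    rw [Nat.zero_add, hsT j m] at h
    exact h.symm
  refine ⟨fun M => (s (M + 1)).1 0, fun m => (s (m + 1)).2.1 0, fun m => hgrow (s (m + 1)),
    hcop, fun m j hj hjk => ?_, fun m => ?_⟩
  · have h := hmod1 (s (m + k)) (k - j - 1) (by omega)
    have e1 := hsT (k - 1) m
    have e2 := hsT (k - j - 1) (m + j)
    rw [show m + (k - 1) + 1 = m + k by omega] at e1
    rw [show m + j + (k - j - 1) + 1 = m + k by omega] at e2
    rw [e1, e2] at h
    exact h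
  · have h := hmod2 (s (m + 2 * k))
    have e1 := hsT (2 * k - 1) m
    have e2 := hsT (k - 1) (m + k)
    rw [show m + (2 * k - 1) + 1 = m + 2 * k by omega] at e1
    rw [show m + k + (k - 1) + 1 = m + 2 * k by omega] at e2
    rw [e1, e2] at h
    exact h

theorem IsDenominatorSeq.two_mul_le {k : ℕ} {T : ℕ → ℕ} (hT : IsDenominatorSeq k T) (m : ℕ) :
    2 * T m ≤ T (m + 1) := by
  have h1 := hT.pos m
  have h2 := hT.growth m
  nlinarith

theorem IsDenominatorSeq.strictMono {k : ℕ} {T : ℕ → ℕ} (hT : IsDenominatorSeq k T) :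
    StrictMono T :=
  strictMono_nat_of_lt_succ fun m => by
    have h1 := hT.pos m
    have h2 := hT.two_mul_le m
    omega

/-! ### The sets of drop times -/

/-- The indices of the tuple: unordered pairs of residues modulo `k`, possibly equal, written
in increasing order. -/
abbrev ResiduePair (k : ℕ) : Type := {s : Fin k × Fin k // s.1 ≤ s.2}

/-- The increasing enumeration of the natural numbers whose residue modulo `k` belongs to `s`. -/
def dropIndex {k : ℕ} (s : ResiduePair k) (ν : ℕ) : ℕ :=
  if s.1.1 = s.1.2 then s.1.1 + k * ν
  else if ν % 2 = 0 then s.1.1 + k * (ν / 2) else s.1.2 + k * (ν / 2)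

theorem dropIndex_of_eq {k : ℕ} {s : ResiduePair k} (h : s.1.1 = s.1.2) (ν : ℕ) :
    dropIndex s (ν + 1) = dropIndex s ν + k := by
  simp only [dropIndex, if_pos h]; ring

theorem dropIndex_of_ne {k : ℕ} {s : ResiduePair k} (h : s.1.1 ≠ s.1.2) (ν : ℕ) :
    dropIndex s ν < dropIndex s (ν + 1) ∧ dropIndex s (ν + 2) = dropIndex s ν + k := by
  have hlt : (s.1.1 : ℕ) < s.1.2 := lt_of_le_of_ne s.2 (fun e => h (Fin.ext e))
  have h2 := s.1.2.2
  obtain ⟨r, rfl | rfl⟩ := ν.even_or_odd'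
  · have e0 : dropIndex s (2 * r) = s.1.1 + k * r := by
      simp [dropIndex, h]
    have e1 : dropIndex s (2 * r + 1) = s.1.2 + k * r := by
      have : (2 * r + 1) / 2 = r := by omega
      simp [dropIndex, h, this]
    have e2 : dropIndex s (2 * r + 2) = s.1.1 + k * (r + 1) := by
      have : (2 * r + 2) / 2 = r + 1 := by omega
      simp [dropIndex, h, this]
    rw [e0, e1, e2]
    exact ⟨by omega, by ring⟩
  · have e0 : dropIndex s (2 * r + 1) = s.1.2 + k * r := by
      have : (2 * r + 1) / 2 = r := by omega
      simp [dropIndex, h, this]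
    have e1 : dropIndex s (2 * r + 1 + 1) = s.1.1 + k * (r + 1) := by
      have : (2 * r + 1 + 1) / 2 = r + 1 := by omega
      have h3 : (2 * r + 1 + 1) % 2 = 0 := by omega
      simp [dropIndex, h, this, h3]
    have e2 : dropIndex s (2 * r + 1 + 2) = s.1.2 + k * (r + 1) := by
      have h2 : (2 * r + 1 + 2) / 2 = r + 1 := by omega
      have h3 : (2 * r + 1 + 2) % 2 = 1 := by omega
      simp [dropIndex, h, h2, h3]
    rw [e0, e1, e2]
    exact ⟨by rw [mul_add]; omega, by ring⟩

theorem dropIndex_strictMono {k : ℕ} (s : ResiduePair k) : StrictMono (dropIndex s) :=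
  strictMono_nat_of_lt_succ fun ν => by
    by_cases h : s.1.1 = s.1.2
    · rw [dropIndex_of_eq h]
      have := s.1.1.2
      omega
    · exact (dropIndex_of_ne h ν).1

theorem dropIndex_cast {k : ℕ} (s : ResiduePair k) (ν : ℕ) :
    (dropIndex s ν : ZMod k) = (s.1.1 : ℕ) ∧ (dropIndex s (ν + 1) : ZMod k) = (s.1.2 : ℕ) ∨
      (dropIndex s ν : ZMod k) = (s.1.2 : ℕ) ∧ (dropIndex s (ν + 1) : ZMod k) = (s.1.1 : ℕ) := by
  by_cases h : s.1.1 = s.1.2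
  · simp [dropIndex, h]
  · obtain ⟨r, rfl | rfl⟩ := ν.even_or_odd'
    · left
      simp [dropIndex, h]
    · right
      have : (2 * r + 1 + 1) % 2 = 0 := by omega
      simp [dropIndex, h, this]

theorem IsDenominatorSeq.dropIndex_modEq {k : ℕ} {T : ℕ → ℕ} (hT : IsDenominatorSeq k T)
    (s : ResiduePair k) (ν : ℕ) :
    T (dropIndex s (ν + 2)) ≡ T (dropIndex s ν) [MOD T (dropIndex s (ν + 1))] := by
  by_cases h : s.1.1 = s.1.2
  · rw [dropIndex_of_eq h (ν + 1), dropIndex_of_eq h ν, add_assoc, ← two_mul]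
    exact hT.modEq_two_mul _
  · obtain ⟨h1, h2⟩ := dropIndex_of_ne h ν
    have h3 := (dropIndex_of_ne h (ν + 1)).1
    rw [show ν + 1 + 1 = ν + 2 from rfl, h2] at h3
    obtain ⟨j, hj⟩ := Nat.exists_eq_add_of_lt h1
    rw [h2, hj]
    exact hT.modEq _ (j + 1) (by omega) (by omega)

theorem IsDenominatorSeq.dropIndex_coprime {k : ℕ} {T : ℕ → ℕ} (hT : IsDenominatorSeq k T)
    (s : ResiduePair k) : (T (dropIndex s 0)).Coprime (T (dropIndex s 1)) := by
  have hk := s.1.1.2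
  by_cases h : s.1.1 = s.1.2
  · rw [dropIndex_of_eq h 0]
    exact hT.coprime _ _ (by omega) le_rfl
  · obtain ⟨h1, h2⟩ := dropIndex_of_ne h 0
    have h3 := (dropIndex_of_ne h 1).1
    rw [show 1 + 1 = 0 + 2 from rfl, h2] at h3
    obtain ⟨j, hj⟩ := Nat.exists_eq_add_of_lt h1
    rw [Nat.zero_add] at hj
    rw [hj]
    exact hT.coprime _ (j + 1) (by omega) (by omega)

/-! ### The ordering attached to a residue -/

/-- How far one has to go up from a number of residue `r` to reach the residue `c`. -/
def gap {k : ℕ} (r : ZMod k) (c : Fin k) : ℕ := (((c : ℕ) : ZMod k) - r).val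

/-- Distance from a number of residue `r` to the first number at or above it with residue
in `s`. -/
def firstGap {k : ℕ} (r : ZMod k) (s : ResiduePair k) : ℕ := min (gap r s.1.1) (gap r s.1.2)

/-- Distance from a number of residue `r` to the second number at or above it with residue
in `s`. -/
def secondGap {k : ℕ} (r : ZMod k) (s : ResiduePair k) : ℕ :=
  if s.1.1 = s.1.2 then gap r s.1.1 + k else max (gap r s.1.1) (gap r s.1.2)

/-- The sorting key: on the stretch between consecutive drop times that ends at a drop time
with index of residue `r`, a smaller key means a larger value of `ψ`. -/
def orderKey {k : ℕ} (r : ZMod k) (s : ResiduePair k) : ℕ ×ₗ ℕᵒᵈ :=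
  toLex (firstGap r s, OrderDual.toDual (secondGap r s))

theorem gap_lt {k : ℕ} [NeZero k] (r : ZMod k) (c : Fin k) : gap r c < k := ZMod.val_lt _

theorem eq_add_gap {k : ℕ} [NeZero k] {M x : ℕ} {c : Fin k} (h1 : M ≤ x) (h2 : x < M + k)
    (h : (x : ZMod k) = (c : ℕ)) : x = M + gap (M : ZMod k) c := by
  obtain ⟨y, rfl⟩ := Nat.exists_eq_add_of_le h1
  rw [gap, ← h]
  push_cast
  rw [add_sub_cancel_left, ZMod.val_natCast_of_lt (by omega)]

theorem gap_injective {k : ℕ} [NeZero k] (r : ZMod k) : Function.Injective (gap (k := k) r) := by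
  intro c d h
  have h1 := sub_left_injective (ZMod.val_injective k h)
  have h2 := congrArg ZMod.val h1
  rw [ZMod.val_natCast_of_lt c.2, ZMod.val_natCast_of_lt d.2] at h2
  exact Fin.ext h2

theorem orderKey_injective {k : ℕ} [NeZero k] (r : ZMod k) :
    Function.Injective (orderKey (k := k) r) := by
  rintro ⟨⟨a, b⟩, hab⟩ ⟨⟨c, d⟩, hcd⟩ h
  have h1 : firstGap r ⟨(a, b), hab⟩ = firstGap r ⟨(c, d), hcd⟩ :=
    congrArg (fun z => (ofLex z).1) h
  have h2 : secondGap r ⟨(a, b), hab⟩ = secondGap r ⟨(c, d), hcd⟩ :=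
    congrArg (fun z => OrderDual.ofDual (ofLex z).2) h
  have ha := gap_lt r a
  have hb := gap_lt r b
  have hc := gap_lt r c
  have hd := gap_lt r d
  simp only [firstGap, secondGap] at h1 h2 hab hcd
  have key : (gap r a = gap r c ∧ gap r b = gap r d) ∨
      (gap r a = gap r d ∧ gap r b = gap r c) := by
    split_ifs at h2 with e1 e2 e2
    · subst e1 e2; omega
    · omega
    · omega
    · omega
  rcases key with ⟨e1, e2⟩ | ⟨e1, e2⟩
  · obtain rfl := gap_injective r e1
    obtain rfl := gap_injective r e2
    rfl
  · obtain rfl := gap_injective r e1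
    obtain rfl := gap_injective r e2
    obtain rfl := le_antisymm hab hcd
    rfl

/-- In state `c` the pair `{c, c}` precedes `{d, d}`; hence different states have different
orderings. -/
theorem orderKey_diag_lt {k : ℕ} [NeZero k] {c d : Fin k} (h : c ≠ d) :
    orderKey ((c : ℕ) : ZMod k) ⟨(c, c), le_rfl⟩ <
      orderKey ((c : ℕ) : ZMod k) ⟨(d, d), le_rfl⟩ := by
  rw [orderKey, orderKey, Prod.Lex.toLex_lt_toLex]
  left
  have h0 : gap ((c : ℕ) : ZMod k) c = 0 := by simp [gap]
  have h1 : gap ((c : ℕ) : ZMod k) d ≠ 0 := fun e => h (gap_injective _ (h0.trans e.symm))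
  simp only [firstGap, min_self, h0]
  omega

/-- Once `M ≥ k`, the first two members at or above `M` of the index set of `s`, as given by
`firstGap` and `secondGap`, are preceded by a member below `M`. -/
theorem exists_dropIndex_stretch {k : ℕ} [NeZero k] (s : ResiduePair k) {M : ℕ} (hM : k ≤ M) :
    ∃ ν, dropIndex s ν < M ∧ dropIndex s (ν + 1) = M + firstGap (M : ZMod k) s ∧
      dropIndex s (ν + 2) = M + secondGap (M : ZMod k) s := by
  have h0 : dropIndex s 0 < M := by
    have : dropIndex s 0 = s.1.1 := by simp [dropIndex]
    rw [this]
    exact s.1.1.2.trans_le hM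
  classical
  have hex : ∃ ν, M ≤ dropIndex s ν := ⟨M, (dropIndex_strictMono s).le_apply⟩
  obtain ⟨ν, hν⟩ : ∃ ν, Nat.find hex = ν + 1 := Nat.exists_eq_succ_of_ne_zero fun h => by
    have := Nat.find_spec hex
    rw [h] at this
    omega
  have hge : M ≤ dropIndex s (ν + 1) := hν ▸ Nat.find_spec hex
  have hlt : dropIndex s ν < M := not_le.1 (Nat.find_min hex (by omega))
  refine ⟨ν, hlt, ?_⟩
  by_cases h : s.1.1 = s.1.2
  · have e := dropIndex_of_eq h ν
    have hc : (dropIndex s (ν + 1) : ZMod k) = (s.1.1 : ℕ) := by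
      rcases dropIndex_cast s ν with hc | hc
      · rw [hc.2, h]
      · exact hc.2
    have h1 := eq_add_gap hge (by omega) hc
    simp only [firstGap, secondGap, ← h, if_true, min_self]
    refine ⟨h1, ?_⟩
    rw [dropIndex_of_eq h (ν + 1), h1, add_assoc]
  · have e := (dropIndex_of_ne h ν).2
    have e1 := (dropIndex_of_ne h (ν + 1)).1
    rw [show ν + 1 + 1 = ν + 2 from rfl] at e1
    simp only [firstGap, secondGap, if_neg h]
    rcases dropIndex_cast s (ν + 1) with ⟨c1, c2⟩ | ⟨c1, c2⟩
    · have h1 := eq_add_gap hge (by omega) c1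
      have h2 := eq_add_gap (by omega : M ≤ dropIndex s (ν + 2)) (by omega) c2
      omega
    · have h1 := eq_add_gap hge (by omega) c1
      have h2 := eq_add_gap (by omega : M ≤ dropIndex s (ν + 2)) (by omega) c2
      omega

/-! ### Comparison of the irrationality measure functions -/

/-- The values of `ψ_α` on all stretches `[T m, T (m + 1))`, `m ≥ k`, when the convergent
denominators of `α` are the `T (dropIndex s ν)`. The value `δ` there is tied to the next value
`δ'` and to the current denominator `u` by the determinant identity. -/
def HasDropsAt {k : ℕ} (T : ℕ → ℕ) (s : ResiduePair k) (α : ℝ) : Prop :=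
  ∀ m, k ≤ m → ∃ (u : ℕ) (δ δ' : ℝ),
    (∀ t, (T m : ℝ) ≤ t → t < T (m + 1) → psi α t = δ) ∧ 1 ≤ u ∧ u ≤ T m ∧
    T (m + 1 + firstGap (m + 1 : ℕ) s) * δ + u * δ' = 1 ∧
    T (m + 1 + firstGap (m + 1 : ℕ) s) * δ < 1 ∧
    1 < 2 * (T (m + 1 + firstGap (m + 1 : ℕ) s) * δ) ∧
    T (m + 1 + secondGap (m + 1 : ℕ) s) * δ' < 1 ∧
    1 < 2 * (T (m + 1 + secondGap (m + 1 : ℕ) s) * δ')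

theorem IsDenominatorSeq.exists_hasDropsAt {k : ℕ} [NeZero k] {T : ℕ → ℕ}
    (hT : IsDenominatorSeq k T) (s : ResiduePair k) : ∃ α, HasDropsAt T s α := by
  have hmono : StrictMono fun ν => T (dropIndex s ν) := hT.strictMono.comp (dropIndex_strictMono s)
  obtain ⟨α, δ, hpsi, hdet, hpos, hanti⟩ := exists_real_with_denominators
    (fun ν => T (dropIndex s ν)) (hT.pos _) hmono (hT.dropIndex_coprime s) (hT.dropIndex_modEq s)
  have hlt : ∀ ν, T (dropIndex s (ν + 1)) * δ ν < 1 := fun ν => by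
    have h1 : (0 : ℝ) < T (dropIndex s ν) := by exact_mod_cast hT.pos _
    have := mul_pos h1 (hpos (ν + 1))
    linarith [hdet ν]
  have hgt : ∀ ν, 1 < 2 * (T (dropIndex s (ν + 1)) * δ ν) := fun ν => by
    have h1 : (T (dropIndex s ν) : ℝ) < T (dropIndex s (ν + 1)) := by
      exact_mod_cast hmono (Nat.lt_succ_self ν)
    have h2 : (T (dropIndex s ν) : ℝ) * δ (ν + 1) < T (dropIndex s (ν + 1)) * δ ν :=
      mul_lt_mul'' h1 (hanti ν) (Nat.cast_nonneg _) (hpos _).le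
    linarith [hdet ν]
  refine ⟨α, fun m hm => ?_⟩
  obtain ⟨ν, h0, h1, h2⟩ := exists_dropIndex_stretch s (M := m + 1) (by omega)
  refine ⟨T (dropIndex s ν), δ ν, δ (ν + 1), fun t ht1 ht2 => hpsi ν t ?_ ?_, hT.pos _,
    hT.strictMono.monotone (by omega), ?_⟩
  · exact le_trans (by exact_mod_cast hT.strictMono.monotone (by omega)) ht1
  · exact ht2.trans_le (by exact_mod_cast hT.strictMono.monotone (by omega))
  · rw [← h1, ← h2]
    exact ⟨hdet ν, hlt ν, hgt ν, hlt (ν + 1), hgt (ν + 1)⟩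

/-- On each stretch the functions `ψ` are ordered by the sorting key: the earlier next drop
wins because `ψ` is within a factor `2` of the inverse of the next drop time, and ties are
decided by the second next drop through the determinant identity. -/
theorem IsDenominatorSeq.psi_lt_psi {k : ℕ} {T : ℕ → ℕ} (hT : IsDenominatorSeq k T)
    {s s' : ResiduePair k} {α α' : ℝ} (hα : HasDropsAt T s α) (hα' : HasDropsAt T s' α')
    {m : ℕ} (hm : k ≤ m) {t : ℝ} (ht1 : (T m : ℝ) ≤ t) (ht2 : t < T (m + 1))
    (hkey : orderKey (m + 1 : ℕ) s < orderKey (m + 1 : ℕ) s') : psi α' t < psi α t := by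
  obtain ⟨u, δ, ε, hp, hu, huT, hd, h1, h2, h3, h4⟩ := hα m hm
  obtain ⟨u', δ', ε', hp', hu', huT', hd', h1', h2', h3', h4'⟩ := hα' m hm
  rw [hp t ht1 ht2, hp' t ht1 ht2]
  have hpos : ∀ m, (0 : ℝ) < T m := fun m => by exact_mod_cast hT.pos m
  rw [orderKey, orderKey, Prod.Lex.toLex_lt_toLex] at hkey
  set f := m + 1 + firstGap (m + 1 : ℕ) s with hf
  set f' := m + 1 + firstGap (m + 1 : ℕ) s' with hf'
  set g := m + 1 + secondGap (m + 1 : ℕ) s with hg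
  set g' := m + 1 + secondGap (m + 1 : ℕ) s' with hg'
  rcases hkey with hlt | ⟨heq, hlt⟩
  · have hff : f + 1 ≤ f' := by simp only at hlt; omega
    have h5 : (2 * T f : ℝ) ≤ T f' := by
      exact_mod_cast (hT.two_mul_le f).trans (hT.strictMono.monotone hff)
    have hδ : 0 < δ := by
      by_contra! h
      nlinarith [hpos f]
    by_contra! h
    nlinarith [hpos f, hpos f']
  · have hff : f' = f := by simp only at heq; omega
    have hgg : g' + 1 ≤ g := by
      simp only [OrderDual.toDual_lt_toDual] at hlt
      omega
    rw [hff] at hd'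
    have hmg : m ≤ g' := by omega
    have hε' : 0 < ε' := by
      by_contra! h
      nlinarith [hpos g']
    have hε : 0 < ε := by
      by_contra! h
      nlinarith [hpos g]
    have h5 : 2 * (T g' : ℝ) ^ 2 ≤ T g := by
      exact_mod_cast (hT.growth g').trans (hT.strictMono.monotone hgg)
    have h6 : (T m : ℝ) ≤ T g' := by exact_mod_cast hT.strictMono.monotone hmg
    -- `T m * ε < ε'` since `2 * T g' * (T m * ε) ≤ T g * ε < 1 < 2 * T g' * ε'`.
    have h7 : (T m : ℝ) * ε < ε' := by
      have h8 : 2 * T g' * (T m * ε) ≤ T g * ε := by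
        have : 2 * (T g' : ℝ) * T m ≤ T g := by nlinarith [hpos g']
        nlinarith
      by_contra! h
      nlinarith [hpos g']
    have h8 : (u : ℝ) * ε ≤ T m * ε := mul_le_mul_of_nonneg_right (by exact_mod_cast huT) hε.le
    have h9 : ε' ≤ u' * ε' := le_mul_of_one_le_left hε'.le (by exact_mod_cast hu')
    have h10 : (T f : ℝ) * δ' < T f * δ := by linarith
    exact lt_of_mul_lt_mul_left h10 (hpos f).le

theorem IsDenominatorSeq.exists_stretch {k : ℕ} {T : ℕ → ℕ} (hT : IsDenominatorSeq k T)
    {t : ℝ} (ht : (T k : ℝ) ≤ t) : ∃ m, k ≤ m ∧ (T m : ℝ) ≤ t ∧ t < T (m + 1) := by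
  classical
  have hex : ∃ m, t < T m := by
    obtain ⟨N, hN⟩ := exists_nat_gt t
    exact ⟨N, hN.trans_le (by exact_mod_cast hT.strictMono.le_apply)⟩
  have hk : k < Nat.find hex := by
    by_contra! h
    have h1 := Nat.find_spec hex
    have h2 : (T (Nat.find hex) : ℝ) ≤ T k := by exact_mod_cast hT.strictMono.monotone h
    linarith
  obtain ⟨m, hm⟩ : ∃ m, Nat.find hex = m + 1 := Nat.exists_eq_succ_of_ne_zero (by omega)
  exact ⟨m, by omega, not_lt.1 (Nat.find_min hex (by omega)), hm ▸ Nat.find_spec hex⟩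

/-! ### Counting the recurring orderings -/

theorem card_residuePair (k : ℕ) : Fintype.card (ResiduePair k) = k * (k + 1) / 2 := by
  rw [← Fintype.card_congr Sym2.sortEquiv, Sym2.card, Fintype.card_fin, Nat.choose_two_right,
    Nat.add_sub_cancel, mul_comm]

theorem mainTheorem2 (k n : ℕ) (hk : 3 ≤ k) (hn : n = k * (k + 1) / 2) :
    ∃ α : Fin n → ℝ,
      (Pairwise fun i j : Fin n => Incommensurable (α i) (α j)) ∧ kIndex α = k := by
  have : NeZero k := ⟨by omega⟩
  obtain ⟨T, hT⟩ := exists_isDenominatorSeq (k := k) (by omega)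
  choose β hβ using fun s : ResiduePair k => hT.exists_hasDropsAt s
  let e : Fin n ≃ ResiduePair k :=
    (Fintype.equivFinOfCardEq ((card_residuePair k).trans hn.symm)).symm
  have hinj : ∀ r : ZMod k, Function.Injective fun i => orderKey r (e i) := fun r =>
    (orderKey_injective r).comp e.injective
  -- The recurring orderings, one for each residue class of the next drop index.
  let σ : ZMod k → Equiv.Perm (Fin n) := fun r => Tuple.sort fun i => orderKey r (e i)
  have hσ : ∀ r, StrictMono fun j => orderKey r (e (σ r j)) := fun r =>
    (Tuple.monotone_sort fun i => orderKey r (e i)).strictMono_of_injective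
      ((hinj r).comp (σ r).injective)
  have hord : ∀ m, k ≤ m → ∀ t, (T m : ℝ) ≤ t → t < T (m + 1) →
      IsOrderingAt (fun i => β (e i)) t (σ (m + 1 : ℕ)) := fun m hm t h1 h2 i j hij =>
    hT.psi_lt_psi (hβ _) (hβ _) hm h1 h2 (hσ _ hij)
  have huniq : ∀ t (τ τ' : Equiv.Perm (Fin n)), IsOrderingAt (fun i => β (e i)) t τ →
      IsOrderingAt (fun i => β (e i)) t τ' → τ = τ' := by
    intro t τ τ' h h'
    have := Tuple.unique_monotone (f := fun i => - psi (β (e i)) t) (σ := τ) (τ := τ')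
      (fun i j hij => neg_le_neg (h.antitone hij)) (fun i j hij => neg_le_neg (h'.antitone hij))
    have hi : Function.Injective fun i => - psi (β (e i)) t := by
      intro i j hij
      have := h.injective (a₁ := τ.symm i) (a₂ := τ.symm j) (by simpa using hij)
      exact τ.symm.injective this
    exact Equiv.ext fun i => hi (congrFun this i)
  have hσinj : Function.Injective fun c : Fin k => σ ((c : ℕ) : ZMod k) := by
    intro c d hcd
    by_contra hne
    have h1 := orderKey_diag_lt hne
    have h2 := orderKey_diag_lt (Ne.symm hne)
    simp only at hcd
    have m1 := hσ ((c : ℕ) : ZMod k)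
    have m2 := hσ ((d : ℕ) : ZMod k)
    rw [← hcd] at m2
    set τ := σ ((c : ℕ) : ZMod k)
    obtain ⟨i, hi⟩ := (τ.trans e).surjective ⟨(c, c), le_rfl⟩
    obtain ⟨j, hj⟩ := (τ.trans e).surjective ⟨(d, d), le_rfl⟩
    rw [← hi, ← hj] at h1 h2
    exact lt_asymm (m1.lt_iff_lt.1 h1) (m2.lt_iff_lt.1 h2)
  refine ⟨fun i => β (e i), fun i j hij => ?_, ?_⟩
  · filter_upwards [Filter.eventually_ge_atTop (T k : ℝ)] with t ht
    obtain ⟨m, hm, h1, h2⟩ := hT.exists_stretch ht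
    intro h
    have := (hord m hm t h1 h2).injective (a₁ := (σ (m + 1 : ℕ)).symm i)
      (a₂ := (σ (m + 1 : ℕ)).symm j) (by simpa using h)
    exact hij ((σ (m + 1 : ℕ)).symm.injective this)
  · refine (isGreatest_kIndex _).unique ⟨⟨fun c => σ ((c : ℕ) : ZMod k), hσinj, ?_⟩, ?_⟩
    · intro c t₀ _
      -- An index `m + 1` of residue `c` with `T m` beyond `t₀`.
      obtain ⟨N, hN⟩ := exists_nat_gt t₀
      obtain ⟨m, hm⟩ : ∃ m, m + 1 = c + k * (N + 2) :=
        ⟨c + k * (N + 2) - 1, Nat.sub_add_cancel (by nlinarith)⟩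
      have hkm : k ≤ m := by nlinarith
      have hNm : N ≤ m := by nlinarith
      refine ⟨T m, hN.trans_le ?_, ?_⟩
      · exact_mod_cast hNm.trans hT.strictMono.le_apply
      · have h := hord m hkm (T m) le_rfl (by exact_mod_cast hT.strictMono (Nat.lt_succ_self m))
        rw [hm] at h
        simpa using h
    · rintro l ⟨τ, hτ, hrec⟩
      have hex : ∀ j, ∃ r : ZMod k, τ j = σ r := fun j => by
        obtain ⟨t, ht, hj⟩ := hrec j (T k) (by exact_mod_cast hT.pos k)
        obtain ⟨m, hm, h1, h2⟩ := hT.exists_stretch ht.le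
        exact ⟨(m + 1 : ℕ), huniq t _ _ hj (hord m hm t h1 h2)⟩
      choose r hr using hex
      have hrinj : Function.Injective r := fun i j hij => hτ (by rw [hr, hr, hij])
      simpa [ZMod.card] using Fintype.card_le_of_injective r hrinj
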